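/- Let $d, M \ge 1$ be integers, let $\Omega \subset \mathbb{R}^d$ be a bounded open set (in particular, $\Omega$ may be any bounded connected Lipschitz domain or any bounded connected extension domain), let $\nu_1 < \dots < \nu_M$ be integers, and let $\alpha > 0$. For $u \in L^1(\Omega)$ define the total variation $$\mathrm{TV}(u) = \sup\left\{ \int_\Omega u(x)\, \nabla\cdot\phi(x)\,dx \;\middle|\; \phi \in C^1_c(\Omega)^d,\ \sup_{s\in\Omega}\|\phi(s)\| \le 1 \right\} \in [0,\infty],$$ where $\|\cdot\|$ is the Euclidean norm, and let $BV(\Omega)$ be the set of all $u \in L^1(\Omega)$ with $\mathrm{TV}(u) < \infty$. Let $F : L^2(\Omega) \to \mathbb{R}$ be lower semicontinuous with respect to the norm topology of $L^2(\Omega)$ and bounded from below. Then the problem $$\min_{v \in L^2(\Omega)}\ J(v) := F(v) + \alpha\,\mathrm{TV}(v) \quad \text{subject to} \quad v(x) \in \{\nu_1,\dots,\nu_M\} \text{ for almost every } x \in \Omega$$ has a minimizer in $BV(\Omega)$: there is a feasible $\bar v \in L^2(\Omega) \cap BV(\Omega)$ with $J(\bar v) \le J(v)$ for every feasible $v \in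 L^2(\Omega)$. -/

import Mathlib

open MeasureTheory
open scoped ENNReal

noncomputable section

namespace TVControl

/-- The divergence `∇ · φ = ∑ i, ∂ φ_i / ∂ x_i` of a vector field on `ℝ^d`. -/
def divergence {d : ℕ} (φ : EuclideanSpace ℝ (Fin d) → EuclideanSpace ℝ (Fin d))
    (x : EuclideanSpace ℝ (Fin d)) : ℝ :=
  ∑ i : Fin d, (fderiv ℝ φ x (EuclideanSpace.single i 1)) i

/-- The vector fields `φ ∈ C^1_c(Ω)^d` (extended by zero to `ℝ^d`) whose Euclidean norm is at most
`1` at every point of `Ω`. -/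
structure IsTestField {d : ℕ} (Ω : Set (EuclideanSpace ℝ (Fin d)))
    (φ : EuclideanSpace ℝ (Fin d) → EuclideanSpace ℝ (Fin d)) : Prop where
  contDiff : ContDiff ℝ 1 φ
  hasCompactSupport : HasCompactSupport φ
  tsupport_subset : tsupport φ ⊆ Ω
  norm_le_one : ∀ x ∈ Ω, ‖φ x‖ ≤ 1

/-- The total variation of `u` in `Ω`,
`TV(u) = sup { ∫_Ω u ∇·φ dx | φ ∈ C^1_c(Ω)^d, sup_Ω ‖φ‖ ≤ 1 } ∈ [0, ∞]`.
Since `φ = 0` is admissible, the supremum is nonnegative, so replacing negative integrals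
by `0` (`ENNReal.ofReal`) does not change it; see `coe_totalVariation`. -/
def totalVariation {d : ℕ} (Ω : Set (EuclideanSpace ℝ (Fin d)))
    (u : EuclideanSpace ℝ (Fin d) → ℝ) : ℝ≥0∞ :=
  ⨆ (φ : EuclideanSpace ℝ (Fin d) → EuclideanSpace ℝ (Fin d)) (_ : IsTestField Ω φ),
    ENNReal.ofReal (∫ x in Ω, u x * divergence φ x)

theorem isTestField_zero {d : ℕ} (Ω : Set (EuclideanSpace ℝ (Fin d))) :
    IsTestField Ω (fun _ => 0) where
  contDiff := contDiff_const
  hasCompactSupport := HasCompactSupport.zero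
  tsupport_subset := by simp [tsupport]
  norm_le_one := by simp

/-- The total variation is the supremum of the integrals in the extended reals. -/
theorem coe_totalVariation {d : ℕ} (Ω : Set (EuclideanSpace ℝ (Fin d)))
    (u : EuclideanSpace ℝ (Fin d) → ℝ) :
    (totalVariation Ω u : EReal) =
      ⨆ (φ : EuclideanSpace ℝ (Fin d) → EuclideanSpace ℝ (Fin d)) (_ : IsTestField Ω φ),
        ((∫ x in Ω, u x * divergence φ x : ℝ) : EReal) := by
  set S : EReal :=
    ⨆ (φ : EuclideanSpace ℝ (Fin d) → EuclideanSpace ℝ (Fin d)) (_ : IsTestField Ω φ),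
      ((∫ x in Ω, u x * divergence φ x : ℝ) : EReal) with hS
  have h0 : 0 ≤ S := by
    have h := le_iSup₂ (f := fun (φ : EuclideanSpace ℝ (Fin d) → EuclideanSpace ℝ (Fin d))
      (_ : IsTestField Ω φ) => ((∫ x in Ω, u x * divergence φ x : ℝ) : EReal))
      _ (isTestField_zero Ω)
    have hz : (∫ x in Ω, u x * divergence (fun _ => (0 : EuclideanSpace ℝ (Fin d))) x) = 0 := by
      simp [divergence]
    rw [hz] at h
    exact h
  apply le_antisymm
  · rw [← EReal.coe_toENNReal h0, EReal.coe_ennreal_le_coe_ennreal_iff]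
    refine iSup₂_le fun φ hφ => ?_
    have hr : ENNReal.ofReal (∫ x in Ω, u x * divergence φ x) =
        EReal.toENNReal ((∫ x in Ω, u x * divergence φ x : ℝ) : EReal) := by
      rw [EReal.toENNReal_of_ne_top (EReal.coe_ne_top _), EReal.toReal_coe]
    rw [hr]
    exact EReal.toENNReal_le_toENNReal
        (le_iSup₂ (f := fun (φ : EuclideanSpace ℝ (Fin d) → EuclideanSpace ℝ (Fin d))
          (_ : IsTestField Ω φ) => ((∫ x in Ω, u x * divergence φ x : ℝ) : EReal)) φ hφ)
  · refine iSup₂_le fun φ hφ => ?_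
    refine le_trans ?_ (EReal.coe_ennreal_le_coe_ennreal_iff.2
      (le_iSup₂ (f := fun (φ : EuclideanSpace ℝ (Fin d) → EuclideanSpace ℝ (Fin d))
        (_ : IsTestField Ω φ) => ENNReal.ofReal (∫ x in Ω, u x * divergence φ x)) φ hφ))
    rw [EReal.coe_ennreal_ofReal]
    exact_mod_cast le_max_left _ _

/-- `u ∈ BV(Ω)`: `u ∈ L^1(Ω)` and `TV(u) < ∞`. -/
def MemBV {d : ℕ} (Ω : Set (EuclideanSpace ℝ (Fin d)))
    (u : EuclideanSpace ℝ (Fin d) → ℝ) : Prop :=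
  IntegrableOn u Ω volume ∧ totalVariation Ω u < ∞

/-- The space `L^2(Ω)` of (classes of) real functions on `Ω`, for Lebesgue measure. -/
abbrev L2 {d : ℕ} (Ω : Set (EuclideanSpace ℝ (Fin d))) : Type :=
  Lp ℝ 2 ((volume : Measure (EuclideanSpace ℝ (Fin d))).restrict Ω)

/-- The feasible set: controls `v ∈ L^2(Ω)` with `v(x) ∈ {ν_1, …, ν_M}` for a.a. `x ∈ Ω`. -/
def feasibleSet {d M : ℕ} (Ω : Set (EuclideanSpace ℝ (Fin d))) (ν : Fin M → ℤ) : Set (L2 Ω) :=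
  {v | ∀ᵐ x ∂((volume : Measure (EuclideanSpace ℝ (Fin d))).restrict Ω), ∃ i, v x = (ν i : ℝ)}

/-- The objective `J(v) = F(v) + α TV(v)`, with values in `(-∞, ∞]` when `α > 0`. -/
def objective {d : ℕ} (Ω : Set (EuclideanSpace ℝ (Fin d))) (F : L2 Ω → ℝ) (α : ℝ)
    (v : L2 Ω) : EReal :=
  (F v : EReal) + (α : EReal) * (totalVariation Ω v : EReal)

end TVControl

end

noncomputable section

namespace TVControl

open Set Filter Topology Metric

/-! This is the direct method: `objective` is lower semicontinuous, and a sublevel set of the total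
variation inside the feasible set is compact in `L2 Ω` (`isCompact_feasibleSet_inter`). Feasible
controls outside a suitable sublevel set cannot beat a constant control, which has total variation
zero.

Compactness needs no regularity of the boundary because feasible controls are uniformly bounded. A
bound on the total variation controls translations in `L^1` on compact subsets of `Ω`
(`setIntegral_abs_comp_add_sub_le`), so small-ball averages approximate all the controls there at a
uniform rate (`setIntegral_abs_ballAverage_sub_le`). Along a weakly convergent subsequence these
averages converge pointwise. The remainder of `Ω` has small measure, so the subsequence is Cauchy in
`L^1`, and by boundedness in `L^2`. -/

/-! ### Test fields and weak directional derivatives -/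

theorem divergence_smul_const {d : ℕ} {ψ : EuclideanSpace ℝ (Fin d) → ℝ}
    {x : EuclideanSpace ℝ (Fin d)} (hψ : DifferentiableAt ℝ ψ x) (e : EuclideanSpace ℝ (Fin d)) :
    divergence (fun y => ψ y • e) x = fderiv ℝ ψ x e := by
  have h1 : fderiv ℝ (fun y => ψ y • e) x = (fderiv ℝ ψ x).smulRight e :=
    (hψ.hasFDerivAt.smul_const e).fderiv
  have he : e = ∑ i, e i • EuclideanSpace.single i (1 : ℝ) := by
    ext j
    simp [Finset.sum_apply, Pi.single_apply]
  unfold divergence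
  rw [h1]
  conv_rhs => rw [he]
  simp [mul_comm]

theorem continuous_divergence {d : ℕ} {φ : EuclideanSpace ℝ (Fin d) → EuclideanSpace ℝ (Fin d)}
    (hφ : ContDiff ℝ 1 φ) : Continuous (divergence φ) := by
  have := hφ.continuous_fderiv one_ne_zero
  unfold divergence
  fun_prop

theorem divergence_eq_zero_of_notMem_tsupport {d : ℕ}
    {φ : EuclideanSpace ℝ (Fin d) → EuclideanSpace ℝ (Fin d)} {x : EuclideanSpace ℝ (Fin d)}
    (hx : x ∉ tsupport φ) : divergence φ x = 0 := by
  simp [divergence, fderiv_of_notMem_tsupport (𝕜 := ℝ) hx]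

theorem hasCompactSupport_divergence {d : ℕ}
    {φ : EuclideanSpace ℝ (Fin d) → EuclideanSpace ℝ (Fin d)} (hφ : HasCompactSupport φ) :
    HasCompactSupport (divergence φ) :=
  HasCompactSupport.intro hφ fun _ hx => divergence_eq_zero_of_notMem_tsupport hx

theorem IsTestField.setIntegral_le {d : ℕ} {Ω : Set (EuclideanSpace ℝ (Fin d))}
    {φ : EuclideanSpace ℝ (Fin d) → EuclideanSpace ℝ (Fin d)} (hφ : IsTestField Ω φ)
    {w : EuclideanSpace ℝ (Fin d) → ℝ} {C : ℝ} (hC : 0 ≤ C)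
    (hw : totalVariation Ω w ≤ ENNReal.ofReal C) :
    ∫ x, w x * divergence φ x ≤ C := by
  rw [← setIntegral_eq_integral_of_forall_compl_eq_zero (s := Ω) fun x hx => by
    rw [divergence_eq_zero_of_notMem_tsupport fun h => hx (hφ.tsupport_subset h), mul_zero]]
  exact (ENNReal.ofReal_le_ofReal_iff hC).1 ((le_iSup₂ (f := fun
    (φ : EuclideanSpace ℝ (Fin d) → EuclideanSpace ℝ (Fin d)) (_ : IsTestField Ω φ) =>
    ENNReal.ofReal (∫ x in Ω, w x * divergence φ x)) φ hφ).trans hw)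

theorem isTestField_smul_const {d : ℕ} {Ω : Set (EuclideanSpace ℝ (Fin d))}
    {ψ : EuclideanSpace ℝ (Fin d) → ℝ} (hψ : ContDiff ℝ 1 ψ) (hψc : HasCompactSupport ψ)
    (hψ1 : ∀ x, |ψ x| ≤ 1) (hΩ : tsupport ψ ⊆ Ω) {e : EuclideanSpace ℝ (Fin d)} (he : ‖e‖ ≤ 1) :
    IsTestField Ω fun x => ψ x • e where
  contDiff := by fun_prop
  hasCompactSupport := hψc.smul_right
  tsupport_subset := (closure_mono (Function.support_smul_subset_left ψ fun _ => e)).trans hΩ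
  norm_le_one x _ := by
    rw [norm_smul]
    exact mul_le_one₀ (hψ1 x) (norm_nonneg _) he

/-- The total variation controls derivatives in the weak sense. -/
theorem integral_mul_fderiv_le {d : ℕ} {Ω : Set (EuclideanSpace ℝ (Fin d))}
    {w : EuclideanSpace ℝ (Fin d) → ℝ} {C : ℝ} (hC : 0 ≤ C)
    (hw : totalVariation Ω w ≤ ENNReal.ofReal C)
    {ψ : EuclideanSpace ℝ (Fin d) → ℝ} (hψ : ContDiff ℝ 1 ψ) (hψc : HasCompactSupport ψ)
    (hψ1 : ∀ x, |ψ x| ≤ 1) (hΩ : tsupport ψ ⊆ Ω) (h : EuclideanSpace ℝ (Fin d)) :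
    ∫ x, w x * fderiv ℝ ψ x h ≤ C * ‖h‖ := by
  rcases eq_or_ne h 0 with rfl | h0
  · simp
  have hn : 0 < ‖h‖ := norm_pos_iff.2 h0
  have := (isTestField_smul_const hψ hψc hψ1 hΩ (e := ‖h‖⁻¹ • h)
    (by rw [norm_smul, norm_inv, norm_norm, inv_mul_cancel₀ hn.ne'])).setIntegral_le hC hw
  simp_rw [fun x => divergence_smul_const (hψ.differentiable one_ne_zero x) (‖h‖⁻¹ • h),
    map_smul, smul_eq_mul, mul_left_comm (w _), integral_const_mul] at this
  rwa [inv_mul_le_iff₀ hn, mul_comm] at this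

theorem abs_integral_mul_fderiv_le {d : ℕ} {Ω : Set (EuclideanSpace ℝ (Fin d))}
    {w : EuclideanSpace ℝ (Fin d) → ℝ} {C : ℝ} (hC : 0 ≤ C)
    (hw : totalVariation Ω w ≤ ENNReal.ofReal C)
    {ψ : EuclideanSpace ℝ (Fin d) → ℝ} (hψ : ContDiff ℝ 1 ψ) (hψc : HasCompactSupport ψ)
    (hψ1 : ∀ x, |ψ x| ≤ 1) (hΩ : tsupport ψ ⊆ Ω) (h : EuclideanSpace ℝ (Fin d)) :
    |∫ x, w x * fderiv ℝ ψ x h| ≤ C * ‖h‖ := by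
  refine abs_le.2 ⟨?_, integral_mul_fderiv_le hC hw hψ hψc hψ1 hΩ h⟩
  have := integral_mul_fderiv_le hC hw hψ hψc hψ1 hΩ (-h)
  simp_rw [map_neg, mul_neg, integral_neg, norm_neg] at this
  linarith

/-! ### Translation estimates -/

/-- Translation estimate against a smooth function. -/
theorem integral_mul_comp_sub_sub_le {d : ℕ} {Ω : Set (EuclideanSpace ℝ (Fin d))}
    {w : EuclideanSpace ℝ (Fin d) → ℝ} (hwi : Integrable w) {C : ℝ} (hC : 0 ≤ C)
    (hw : totalVariation Ω w ≤ ENNReal.ofReal C)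
    {ψ : EuclideanSpace ℝ (Fin d) → ℝ} (hψ : ContDiff ℝ 1 ψ) (hψc : HasCompactSupport ψ)
    (hψ1 : ∀ x, |ψ x| ≤ 1) (h : EuclideanSpace ℝ (Fin d))
    (hΩ : ∀ x ∈ tsupport ψ, ∀ t ∈ Icc (0 : ℝ) 1, x + t • h ∈ Ω) :
    (∫ x, w x * ψ (x - h)) - ∫ x, w x * ψ x ≤ C * ‖h‖ := by
  obtain ⟨M, hM⟩ := (hψ.continuous_fderiv one_ne_zero).bounded_above_of_compact_support
    (hψc.fderiv (𝕜 := ℝ))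
  have hd : ∀ t x, HasDerivAt (fun t : ℝ => w x * ψ (x - t • h))
      (w x * fderiv ℝ ψ (x - t • h) (-h)) t := by
    intro t x
    have h1 : HasDerivAt (fun t : ℝ => x - t • h) (-h) t := by
      simpa using ((hasDerivAt_id t).smul_const h).const_sub x
    exact ((hψ.differentiable one_ne_zero _).hasFDerivAt.comp_hasDerivAt t h1).const_mul _
  have hcd := hψ.continuous_fderiv one_ne_zero
  have hcψ := hψ.continuous
  have hwm := hwi.aestronglyMeasurable
  -- The translation acts on `ψ`, so differentiation under the integral requires only integrability
  -- of `w`.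
  have hg : ∀ t : ℝ, HasDerivAt (fun t : ℝ => ∫ x, w x * ψ (x - t • h))
      (∫ x, w x * fderiv ℝ ψ (x - t • h) (-h)) t := by
    intro t
    refine (hasDerivAt_integral_of_dominated_loc_of_deriv_le (𝕜 := ℝ) (s := univ)
      (F := fun t x => w x * ψ (x - t • h))
      (F' := fun t x => w x * fderiv ℝ ψ (x - t • h) (-h))
      (bound := fun x => |w x| * (M * ‖h‖)) univ_mem ?_ ?_ ?_ ?_ ?_ ?_).2
    · refine Eventually.of_forall fun t => hwm.mul (Continuous.aestronglyMeasurable ?_)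
      fun_prop
    · refine hwi.mul_bdd (c := 1) (Continuous.aestronglyMeasurable (by fun_prop)) ?_
      exact Eventually.of_forall fun x => hψ1 _
    · refine hwm.mul (Continuous.aestronglyMeasurable ?_)
      fun_prop
    · refine Eventually.of_forall fun x t _ => ?_
      rw [norm_mul, Real.norm_eq_abs]
      gcongr
      exact ((fderiv ℝ ψ (x - t • h)).le_opNorm _).trans (by rw [norm_neg]; gcongr; exact hM _)
    · exact hwi.abs.mul_const _
    · exact Eventually.of_forall fun x t _ => hd t x
  have hbd : ∀ t ∈ Ico (0 : ℝ) 1, ‖∫ x, w x * fderiv ℝ ψ (x - t • h) (-h)‖ ≤ C * ‖h‖ := by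
    intro t ht
    -- Each intermediate translate of `ψ` is still supported in `Ω`, so the weak derivative bound is
    -- uniform along the segment.
    have key := abs_integral_mul_fderiv_le hC hw (ψ := fun x => ψ (x - t • h)) (by fun_prop)
      (hψc.comp_homeomorph (Homeomorph.subRight (t • h))) (fun x => hψ1 _) ?_ (-h)
    · simpa only [fderiv_comp_sub, norm_neg, Real.norm_eq_abs] using key
    · intro x hx
      have : x ∈ (Homeomorph.subRight (t • h)) ⁻¹' tsupport ψ := by
        rw [← tsupport_comp_eq_preimage]
        exact hx
      simpa using hΩ _ this t ⟨ht.1, ht.2.le⟩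
  have := norm_image_sub_le_of_norm_deriv_le_segment_01'
    (fun t _ => (hg t).hasDerivWithinAt) hbd
  simpa using (le_abs_self _).trans this

/-- A measurable function bounded by `1` and vanishing outside a bounded set is the a.e. limit of
`C^1` functions bounded by `1` and supported near that set. -/
theorem exists_contDiff_seq_tendsto_ae {d : ℕ} {s : EuclideanSpace ℝ (Fin d) → ℝ}
    (hs : Measurable s) (hs1 : ∀ x, |s x| ≤ 1) {K : Set (EuclideanSpace ℝ (Fin d))}
    (hK : Function.support s ⊆ K) {r : ℝ} (hr : 0 < r) :
    ∃ σ : ℕ → EuclideanSpace ℝ (Fin d) → ℝ, (∀ n, ContDiff ℝ 1 (σ n)) ∧ (∀ n x, |σ n x| ≤ 1) ∧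
      (∀ n, tsupport (σ n) ⊆ cthickening r K) ∧
      ∀ᵐ x, Tendsto (fun n => σ n x) atTop (𝓝 (s x)) := by
  have hsi : LocallyIntegrable s := by
    refine (locallyIntegrable_const (1 : ℝ)).mono hs.aestronglyMeasurable ?_
    exact Eventually.of_forall fun x => by simpa using hs1 x
  -- The radii tend to zero with `rOut = 2 * rIn`; the bounded ratio gives convergence at Lebesgue
  -- points, and `rOut ≤ r` controls the supports.
  let φ : ℕ → ContDiffBump (0 : EuclideanSpace ℝ (Fin d)) := fun n =>
    { rIn := r / (n + 1) / 2
      rOut := r / (n + 1)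
      rIn_pos := by positivity
      rIn_lt_rOut := half_lt_self (by positivity) }
  have hφ : Tendsto (fun n => (φ n).rOut) atTop (𝓝 0) := by
    have := tendsto_one_div_add_atTop_nhds_zero_nat (𝕜 := ℝ)
    simpa [φ, div_eq_mul_inv] using this.const_mul r
  have hφr : ∀ n, (φ n).rOut ≤ r := fun n => div_le_self hr.le (by simp)
  refine ⟨fun n => convolution ((φ n).normed volume) s (ContinuousLinearMap.lsmul ℝ ℝ) volume,
    fun n => ?_, fun n x => ?_, fun n => ?_, ?_⟩
  · exact (φ n).hasCompactSupport_normed.contDiff_convolution_left _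
      (φ n).contDiff_normed hsi
  · calc |∫ t, ContinuousLinearMap.lsmul ℝ ℝ ((φ n).normed volume t) (s (x - t))|
        ≤ ∫ t, (φ n).normed volume t := by
          refine norm_integral_le_of_norm_le
            (f := fun t => ContinuousLinearMap.lsmul ℝ ℝ ((φ n).normed volume t) (s (x - t)))
            (φ n).integrable_normed (Eventually.of_forall fun t => ?_)
          rw [ContinuousLinearMap.lsmul_apply, norm_smul, Real.norm_eq_abs,
            abs_of_nonneg ((φ n).nonneg_normed t)]
          exact mul_le_of_le_one_right ((φ n).nonneg_normed t) (hs1 _)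
      _ = 1 := (φ n).integral_normed
  · refine closure_minimal (fun x hx => ?_) isClosed_cthickening
    obtain ⟨a, ha, b, hb, rfl⟩ := support_convolution_subset _ hx
    rw [(φ n).support_normed_eq, mem_ball_zero_iff] at ha
    refine mem_cthickening_of_dist_le _ b _ _ (hK hb) ?_
    simpa [dist_eq_norm] using ha.le.trans (hφr n)
  · refine ContDiffBump.ae_convolution_tendsto_right_of_locallyIntegrable hφ (K := 2)
      (Eventually.of_forall fun n => ?_) hsi
    simp only [φ]
    linarith

/-- Translation estimate in `L^1`. -/
theorem setIntegral_abs_comp_add_sub_le {d : ℕ} {Ω : Set (EuclideanSpace ℝ (Fin d))}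
    {w : EuclideanSpace ℝ (Fin d) → ℝ} (hwm : Measurable w) (hwi : Integrable w)
    {C : ℝ} (hC : 0 ≤ C) (hw : totalVariation Ω w ≤ ENNReal.ofReal C)
    {K : Set (EuclideanSpace ℝ (Fin d))} (hKm : MeasurableSet K) (hKb : Bornology.IsBounded K)
    {r : ℝ} (hr : 0 < r) (hK : cthickening (r + r) K ⊆ Ω)
    {h : EuclideanSpace ℝ (Fin d)} (hh : ‖h‖ ≤ r) :
    ∫ x in K, |w (x + h) - w x| ≤ C * ‖h‖ := by
  classical
  set f : EuclideanSpace ℝ (Fin d) → ℝ := fun x => w (x + h) - w x with hf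
  have hfm : Measurable f := by fun_prop
  have hwi' : Integrable fun x => w (x + h) := hwi.comp_add_right h
  have hfi : Integrable f := hwi'.sub hwi
  -- The sign of `f` on `K` turns the `L^1` norm into a pairing; mollifying it gives admissible
  -- smooth tests.
  let s : EuclideanSpace ℝ (Fin d) → ℝ := K.indicator fun x => if 0 ≤ f x then 1 else -1
  have hsm : Measurable s :=
    (Measurable.ite (measurableSet_le measurable_const hfm) measurable_const
      measurable_const).indicator hKm
  have hs1 : ∀ x, |s x| ≤ 1 := fun x => by
    by_cases hx : x ∈ K <;> simp only [s, hx, indicator_of_mem, indicator_of_notMem,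
      not_false_eq_true]
    · split_ifs <;> simp
    · simp
  obtain ⟨σ, hσ, hσ1, hσK, hσt⟩ :=
    exists_contDiff_seq_tendsto_ae hsm hs1 (K := K) support_indicator_subset hr
  have hfs : ∫ x in K, |f x| = ∫ x, f x * s x := by
    rw [← integral_indicator hKm]
    congr 1 with x
    by_cases hx : x ∈ K
    · simp only [s, hx, indicator_of_mem]
      split_ifs with h0
      · rw [abs_of_nonneg h0, mul_one]
      · rw [abs_of_neg (not_le.1 h0), mul_neg, mul_one]
    · simp [s, hx]
  change ∫ x in K, |f x| ≤ _
  rw [hfs]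
  have hlim : Tendsto (fun n => ∫ x, f x * σ n x) atTop (𝓝 (∫ x, f x * s x)) := by
    refine tendsto_integral_of_dominated_convergence (fun x => |f x|)
      (fun n => hfm.aestronglyMeasurable.mul (hσ n).continuous.aestronglyMeasurable) hfi.abs
      (fun n => Eventually.of_forall fun x => ?_) ?_
    · rw [norm_mul]
      exact mul_le_of_le_one_right (norm_nonneg _) (hσ1 n x)
    · filter_upwards [hσt] with x hx using hx.const_mul _
  refine le_of_tendsto hlim (Eventually.of_forall fun n => ?_)
  have hbd : ∀ {g : EuclideanSpace ℝ (Fin d) → ℝ}, Integrable g →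
      Integrable fun x => g x * σ n x := fun hg =>
    hg.mul_bdd (c := 1) (hσ n).continuous.aestronglyMeasurable (Eventually.of_forall (hσ1 n))
  have hcs : HasCompactSupport (σ n) :=
    (hKb.cthickening.isCompact_closure).of_isClosed_subset (isClosed_tsupport _)
      ((hσK n).trans subset_closure)
  have key := integral_mul_comp_sub_sub_le hwi hC hw (hσ n) hcs (hσ1 n) h
    fun x hx t ht => hK ?_
  · calc ∫ x, f x * σ n x = (∫ x, w (x + h) * σ n x) - ∫ x, w x * σ n x := by
          simp_rw [hf, sub_mul]
          exact integral_sub (hbd hwi') (hbd hwi)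
      _ = (∫ x, w x * σ n (x - h)) - ∫ x, w x * σ n x := by
          rw [← integral_add_right_eq_self (fun x => w x * σ n (x - h)) h]
          simp
      _ ≤ C * ‖h‖ := key
  -- One `r` pays for mollification, the other for translation.
  · refine cthickening_cthickening_subset hr.le hr.le K
      (mem_cthickening_of_dist_le _ x _ _ (hσK n hx) ?_)
    rw [dist_eq_norm, add_sub_cancel_left, norm_smul, Real.norm_eq_abs, abs_of_nonneg ht.1]
    exact (mul_le_of_le_one_left (norm_nonneg _) ht.2).trans hh

/-! ### Averages over balls -/

/-- The average of `w` over the ball of radius `ε` around `x`. -/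
def ballAverage {d : ℕ} (ε : ℝ) (w : EuclideanSpace ℝ (Fin d) → ℝ)
    (x : EuclideanSpace ℝ (Fin d)) : ℝ :=
  (volume.real (ball (0 : EuclideanSpace ℝ (Fin d)) ε))⁻¹ * ∫ h in ball 0 ε, w (x + h)

/-- By translation invariance the average becomes a pairing of `w` with the indicator of a ball,
which weak convergence can see. -/
theorem ballAverage_eq {d : ℕ} (ε : ℝ) (w : EuclideanSpace ℝ (Fin d) → ℝ)
    (x : EuclideanSpace ℝ (Fin d)) :
    ballAverage ε w x =
      (volume.real (ball (0 : EuclideanSpace ℝ (Fin d)) ε))⁻¹ * ∫ y in ball x ε, w y := by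
  have := (measurePreserving_add_left volume x).setIntegral_preimage_emb
    (measurableEmbedding_addLeft x) w (ball x ε)
  rw [ballAverage, ← this]
  simp

theorem volume_real_ball_pos {d : ℕ} {ε : ℝ} (hε : 0 < ε) :
    0 < volume.real (ball (0 : EuclideanSpace ℝ (Fin d)) ε) :=
  ENNReal.toReal_pos (measure_ball_pos _ _ hε).ne' measure_ball_lt_top.ne

theorem measurable_ballAverage {d : ℕ} (ε : ℝ) {w : EuclideanSpace ℝ (Fin d) → ℝ}
    (hw : Measurable w) : Measurable (ballAverage ε w) := by
  have : Measurable (Function.uncurry fun x h : EuclideanSpace ℝ (Fin d) => w (x + h)) := by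
    change Measurable fun p : _ × _ => w (p.1 + p.2)
    fun_prop
  exact (this.stronglyMeasurable.integral_prod_right
    (ν := volume.restrict (ball (0 : EuclideanSpace ℝ (Fin d)) ε))).measurable.const_mul _

theorem abs_ballAverage_le {d : ℕ} {ε : ℝ} (hε : 0 < ε) {w : EuclideanSpace ℝ (Fin d) → ℝ}
    {B : ℝ} (hB : ∀ x, |w x| ≤ B) (x : EuclideanSpace ℝ (Fin d)) : |ballAverage ε w x| ≤ B := by
  have hV := volume_real_ball_pos (d := d) hε
  rw [ballAverage, abs_mul, abs_inv, abs_of_pos hV, inv_mul_le_iff₀ hV, mul_comm]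
  exact norm_setIntegral_le_of_norm_le_const (f := fun h => w (x + h)) measure_ball_lt_top
    fun h _ => hB _

/-- Averages over balls of radius `ε` approximate `w` in `L^1`, at a rate given by the total
variation. -/
theorem setIntegral_abs_ballAverage_sub_le {d : ℕ} {Ω : Set (EuclideanSpace ℝ (Fin d))}
    {w : EuclideanSpace ℝ (Fin d) → ℝ} (hwm : Measurable w) (hwi : Integrable w)
    {B : ℝ} (hB : ∀ x, |w x| ≤ B)
    {C : ℝ} (hC : 0 ≤ C) (hw : totalVariation Ω w ≤ ENNReal.ofReal C)
    {K : Set (EuclideanSpace ℝ (Fin d))} (hKm : MeasurableSet K) (hKb : Bornology.IsBounded K)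
    {ε : ℝ} (hε : 0 < ε) (hK : cthickening (ε + ε) K ⊆ Ω) :
    ∫ x in K, |ballAverage ε w x - w x| ≤ C * ε := by
  set b : Set (EuclideanSpace ℝ (Fin d)) := ball 0 ε with hb
  set V := volume.real b with hVdef
  have hV : 0 < V := volume_real_ball_pos hε
  have : IsFiniteMeasure (volume.restrict K) := ⟨by simpa using hKb.measure_lt_top⟩
  have : IsFiniteMeasure (volume.restrict b) := ⟨by simpa using measure_ball_lt_top⟩
  have hmeas : Measurable fun p : EuclideanSpace ℝ (Fin d) × EuclideanSpace ℝ (Fin d) =>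
      |w (p.1 + p.2) - w p.1| := by fun_prop
  have hbd : ∀ x h, |w (x + h) - w x| ≤ B + B := fun x h =>
    (abs_sub _ _).trans (add_le_add (hB _) (hB _))
  have hint : Integrable (Function.uncurry fun x h => |w (x + h) - w x|)
      ((volume.restrict K).prod (volume.restrict b)) :=
    Integrable.of_bound hmeas.aestronglyMeasurable (B + B)
      (Eventually.of_forall fun p => by simpa [Function.uncurry] using hbd p.1 p.2)
  have hw1 : ∀ x, IntegrableOn (fun h => w (x + h)) b := fun x =>
    (hwi.comp_add_left x).integrableOn
  have hpt : ∀ x, |ballAverage ε w x - w x| ≤ V⁻¹ * ∫ h in b, |w (x + h) - w x| := by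
    intro x
    have : ballAverage ε w x - w x = V⁻¹ * ∫ h in b, (w (x + h) - w x) := by
      rw [integral_sub (hw1 x) (integrable_const _), setIntegral_const, smul_eq_mul, mul_sub,
        inv_mul_cancel_left₀ hV.ne']
      rfl
    rw [this, abs_mul, abs_inv, abs_of_pos hV]
    gcongr
    exact abs_integral_le_integral_abs
  calc ∫ x in K, |ballAverage ε w x - w x|
      ≤ ∫ x in K, V⁻¹ * ∫ h in b, |w (x + h) - w x| := by
        refine integral_mono_of_nonneg (Eventually.of_forall fun x => abs_nonneg _)
          (hint.integral_prod_left.const_mul _) (Eventually.of_forall hpt)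
    -- Fubini puts the translation estimate inside, for each fixed `h`.
    _ = V⁻¹ * ∫ h in b, ∫ x in K, |w (x + h) - w x| := by
        rw [integral_const_mul, integral_integral_swap hint]
    _ ≤ V⁻¹ * ∫ h in b, C * ε := by
        refine mul_le_mul_of_nonneg_left ?_ (inv_nonneg.2 hV.le)
        refine setIntegral_mono_on hint.integral_prod_right (integrable_const _)
          measurableSet_ball fun h hh => ?_
        have hh' : ‖h‖ ≤ ε := (mem_ball_zero_iff.1 hh).le
        exact (setIntegral_abs_comp_add_sub_le hwm hwi hC hw hKm hKb hε hK hh').trans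
          (by gcongr)
    _ = C * ε := by
        rw [setIntegral_const, smul_eq_mul, inv_mul_cancel_left₀ hV.ne']

/-! ### Compactness in `L^1` and `L^2` -/

theorem totalVariation_congr_ae {d : ℕ} {Ω : Set (EuclideanSpace ℝ (Fin d))}
    {u w : EuclideanSpace ℝ (Fin d) → ℝ} (h : u =ᵐ[volume.restrict Ω] w) :
    totalVariation Ω u = totalVariation Ω w := by
  unfold totalVariation
  congr! 4 with φ hφ
  exact integral_congr_ae (h.mono fun x hx => congrArg (· * divergence φ x) hx)

/-- A uniformly bounded sequence with bounded total variation whose averages over balls converge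
is Cauchy in `L^1`. -/
theorem tendsto_setIntegral_abs_sub {d : ℕ} {Ω : Set (EuclideanSpace ℝ (Fin d))}
    (hΩ : IsOpen Ω) (hΩb : Bornology.IsBounded Ω)
    {w : ℕ → EuclideanSpace ℝ (Fin d) → ℝ} (hwm : ∀ n, Measurable (w n))
    (hwi : ∀ n, Integrable (w n)) {B : ℝ} (hB : ∀ n x, |w n x| ≤ B)
    {C : ℝ} (hC : 0 ≤ C) (hw : ∀ n, totalVariation Ω (w n) ≤ ENNReal.ofReal C)
    (hconv : ∀ x ε, ∃ l, Tendsto (fun n => ∫ y in ball x ε, w n y) atTop (𝓝 l)) :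
    Tendsto (fun p : ℕ × ℕ => ∫ x in Ω, |w p.1 x - w p.2 x|) atTop (𝓝 0) := by
  have hB0 : 0 ≤ B := (abs_nonneg _).trans (hB 0 0)
  have hwB : ∀ n m x, |w n x - w m x| ≤ B + B := fun n m x =>
    (abs_sub _ _).trans (add_le_add (hB _ _) (hB _ _))
  refine (nhds_basis_abs_sub_lt (0 : ℝ)).tendsto_right_iff.2 fun η hη => ?_
  -- Differences are at most `B + B`, so the part outside `K` costs at most `η / 4`; the `+ 1` keeps
  -- the denominator positive when `B = 0`.
  obtain ⟨K, hKΩ, hKc, hKv⟩ := hΩ.measurableSet.exists_isCompact_sdiff_lt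
    (hΩb.measure_lt_top (μ := volume)).ne (ε := ENNReal.ofReal (η / (4 * (B + B + 1)))) (by simp; positivity)
  obtain ⟨δ, hδ, hKδ⟩ := hKc.exists_cthickening_subset_open hΩ hKΩ
  -- Each replacement of a function by its averages costs at most `η / 8` on `K`.
  obtain ⟨ε, hε, hεδ, hεC⟩ : ∃ ε > 0, ε + ε ≤ δ ∧ C * ε ≤ η / 8 := by
    refine ⟨min (δ / 2) (η / (8 * (C + 1))), by positivity, ?_, ?_⟩
    · linarith [min_le_left (δ / 2) (η / (8 * (C + 1)))]
    · calc C * min (δ / 2) (η / (8 * (C + 1))) ≤ (C + 1) * (η / (8 * (C + 1))) := by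
            gcongr
            · linarith
            · exact min_le_right _ _
        _ = η / 8 := by field_simp
  have hKε : cthickening (ε + ε) K ⊆ Ω := (cthickening_mono hεδ K).trans hKδ
  have : IsFiniteMeasure (volume.restrict K) := ⟨by simpa using hKc.measure_lt_top⟩
  have hAB : ∀ n x, |ballAverage ε (w n) x| ≤ B := fun n => abs_ballAverage_le hε (hB n)
  have hAm : ∀ n, Measurable (ballAverage ε (w n)) := fun n => measurable_ballAverage ε (hwm n)
  have hAi : ∀ n, IntegrableOn (ballAverage ε (w n)) K := fun n =>
    Integrable.of_bound (hAm n).aestronglyMeasurable B (Eventually.of_forall (hAB n))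
  have hA : Tendsto (fun p : ℕ × ℕ =>
      ∫ x in K, |ballAverage ε (w p.1) x - ballAverage ε (w p.2) x|) atTop (𝓝 0) := by
    rw [← integral_zero (EuclideanSpace ℝ (Fin d)) ℝ (μ := volume.restrict K)]
    refine tendsto_integral_filter_of_dominated_convergence (fun _ => B + B)
      (Eventually.of_forall fun p => ?_) (Eventually.of_forall fun p =>
        Eventually.of_forall fun x => ?_) (integrable_const _) (Eventually.of_forall fun x => ?_)
    · exact (((hAm _).sub (hAm _)).abs).aestronglyMeasurable
    · rw [Real.norm_eq_abs, abs_abs]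
      exact (abs_sub _ _).trans (add_le_add (hAB _ _) (hAB _ _))
    · obtain ⟨l, hl⟩ := hconv x ε
      have h1 : Tendsto (fun n => ballAverage ε (w n) x) atTop
          (𝓝 ((volume.real (ball (0 : EuclideanSpace ℝ (Fin d)) ε))⁻¹ * l)) := by
        simp_rw [ballAverage_eq]
        exact hl.const_mul _
      rw [← prod_atTop_atTop_eq]
      simpa using ((h1.comp tendsto_fst).sub (h1.comp tendsto_snd)).abs
  filter_upwards [hA.eventually (gt_mem_nhds (show (0 : ℝ) < η / 4 by positivity))] with p hp
  rw [sub_zero, abs_of_nonneg (integral_nonneg fun x => abs_nonneg _)]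
  have hi : Integrable fun x => |w p.1 x - w p.2 x| := ((hwi _).sub (hwi _)).abs
  have hsplit : ∫ x in Ω, |w p.1 x - w p.2 x| =
      (∫ x in K, |w p.1 x - w p.2 x|) + ∫ x in Ω \ K, |w p.1 x - w p.2 x| := by
    rw [← setIntegral_union disjoint_sdiff_right (hΩ.measurableSet.diff hKc.measurableSet)
      hi.integrableOn hi.integrableOn, union_sdiff_cancel hKΩ]
  have houter : ∫ x in Ω \ K, |w p.1 x - w p.2 x| ≤ η / 4 := by
    have hfin : volume (Ω \ K) < ∞ := hKv.trans ENNReal.ofReal_lt_top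
    have h1 := norm_setIntegral_le_of_norm_le_const (f := fun x => |w p.1 x - w p.2 x|)
      hfin (C := B + B) fun x _ => by simpa using hwB p.1 p.2 x
    have h2 : volume.real (Ω \ K) ≤ η / (4 * (B + B + 1)) :=
      ENNReal.toReal_le_of_le_ofReal (by positivity) hKv.le
    calc _ ≤ _ := le_abs_self _
      _ ≤ (B + B) * volume.real (Ω \ K) := h1
      _ ≤ (B + B + 1) * (η / (4 * (B + B + 1))) :=
        mul_le_mul (by linarith) h2 measureReal_nonneg (by positivity)
      _ = η / 4 := by field_simp
  have hinner : ∫ x in K, |w p.1 x - w p.2 x| ≤ η / 8 + η / 4 + η / 8 := by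
    have hest : ∀ n, ∫ x in K, |ballAverage ε (w n) x - w n x| ≤ η / 8 := fun n =>
      (setIntegral_abs_ballAverage_sub_le (hwm n) (hwi n) (hB n) hC (hw n) hKc.measurableSet
        hKc.isBounded hε hKε).trans hεC
    have hi1 : ∀ n, IntegrableOn (fun x => |ballAverage ε (w n) x - w n x|) K := fun n =>
      ((hAi n).sub (hwi n).integrableOn).abs
    have hi2 : IntegrableOn
        (fun x => |ballAverage ε (w p.1) x - ballAverage ε (w p.2) x|) K :=
      ((hAi _).sub (hAi _)).abs
    calc ∫ x in K, |w p.1 x - w p.2 x|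
        ≤ ∫ x in K, (|ballAverage ε (w p.1) x - w p.1 x|
            + |ballAverage ε (w p.1) x - ballAverage ε (w p.2) x|
            + |ballAverage ε (w p.2) x - w p.2 x|) := by
          refine integral_mono hi.integrableOn (((hi1 _).add hi2).add (hi1 _)) fun x => ?_
          have h1 := abs_sub_le (w p.1 x) (ballAverage ε (w p.1) x) (w p.2 x)
          have h2 := abs_sub_le (ballAverage ε (w p.1) x) (ballAverage ε (w p.2) x) (w p.2 x)
          rw [abs_sub_comm (w p.1 x) (ballAverage _ _ _)] at h1
          dsimp only
          linarith
      _ = (∫ x in K, |ballAverage ε (w p.1) x - w p.1 x|)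
            + (∫ x in K, |ballAverage ε (w p.1) x - ballAverage ε (w p.2) x|)
            + ∫ x in K, |ballAverage ε (w p.2) x - w p.2 x| := by
          rw [← integral_add (hi1 _) hi2]
          exact integral_add ((hi1 _).add hi2) (hi1 _)
      _ ≤ _ := add_le_add (add_le_add (hest _) hp.le) (hest _)
  linarith

/-- A bounded sequence in a separable Hilbert space has a weakly convergent subsequence. -/
theorem exists_subseq_tendsto_inner {H : Type*} [NormedAddCommGroup H] [InnerProductSpace ℝ H]
    [TopologicalSpace.SeparableSpace H] {v : ℕ → H} {R : ℝ} (hv : ∀ n, ‖v n‖ ≤ R) :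
    ∃ φ : ℕ → ℕ, StrictMono φ ∧
      ∀ g : H, ∃ l, Tendsto (fun n => inner ℝ (v (φ n)) g) atTop (𝓝 l) := by
  -- Sequential Banach–Alaoglu, applied to the functionals `inner ℝ (v n)`.
  obtain ⟨a, -, φ, hφ, ha⟩ := WeakDual.isSeqCompact_closedBall ℝ H 0 R
    (x := fun n => StrongDual.toWeakDual (innerSL ℝ (v n)))
    (fun n => by
      change innerSL ℝ (v n) ∈ closedBall 0 R
      rw [mem_closedBall_zero_iff, innerSL_apply_norm]
      exact hv n)
  exact ⟨φ, hφ, fun g => ⟨a g, ((WeakDual.eval_continuous g).tendsto a).comp ha⟩⟩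

theorem norm_sq_eq_setIntegral {d : ℕ} {Ω : Set (EuclideanSpace ℝ (Fin d))} (v : L2 Ω) :
    ‖v‖ ^ 2 = ∫ x in Ω, v x ^ 2 := by
  rw [← real_inner_self_eq_norm_sq, L2.inner_def]
  simp [sq]

/-- Rellich-type compactness: sequences bounded in `L^∞` and in total variation are relatively
compact in `L^2`. -/
theorem exists_subseq_tendsto_of_totalVariation_le {d : ℕ} {Ω : Set (EuclideanSpace ℝ (Fin d))}
    (hΩ : IsOpen Ω) (hΩb : Bornology.IsBounded Ω) {v : ℕ → L2 Ω} {B : ℝ} (hB0 : 0 ≤ B)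
    (hB : ∀ n, ∀ᵐ x ∂volume.restrict Ω, |v n x| ≤ B)
    {C : ℝ} (hC : 0 ≤ C) (hv : ∀ n, totalVariation Ω (v n) ≤ ENNReal.ofReal C) :
    ∃ φ : ℕ → ℕ, StrictMono φ ∧ ∃ a, Tendsto (v ∘ φ) atTop (𝓝 a) := by
  have hfin : IsFiniteMeasure (volume.restrict Ω) := ⟨by simpa using hΩb.measure_lt_top⟩
  have : Fact ((2 : ℝ≥0∞) ≠ ∞) := ⟨by simp⟩
  obtain ⟨φ, hφ, hlim⟩ := exists_subseq_tendsto_inner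
    (fun n => Lp.norm_le_of_ae_bound (f := v n) hB0 (hB n))
  refine ⟨φ, hφ, cauchySeq_tendsto_of_complete ?_⟩
  -- Truncation makes the bound hold everywhere, and extension by zero makes translates meaningful;
  -- neither changes the class on `Ω`.
  let w : ℕ → EuclideanSpace ℝ (Fin d) → ℝ := fun n =>
    Ω.indicator fun x => max (-B) (min B (v (φ n) x))
  have hwv : ∀ n, w n =ᵐ[volume.restrict Ω] v (φ n) := fun n => by
    filter_upwards [hB (φ n), ae_restrict_mem hΩ.measurableSet] with x hx hxΩ
    have := abs_le.1 hx
    simp only [w, indicator_of_mem hxΩ]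
    rw [min_eq_right this.2, max_eq_right this.1]
  have hwm : ∀ n, Measurable (w n) := fun n =>
    (measurable_const.max (measurable_const.min
      (Lp.stronglyMeasurable (v (φ n))).measurable)).indicator hΩ.measurableSet
  have hwB : ∀ n x, |w n x| ≤ B := fun n x => by
    by_cases hx : x ∈ Ω
    · simp only [w, indicator_of_mem hx]
      exact abs_le.2 ⟨le_max_left _ _, max_le (by linarith) (min_le_left _ _)⟩
    · simpa [w, hx] using hB0
  have hwi : ∀ n, Integrable (w n) := fun n => by
    have : IntegrableOn (w n) Ω :=
      Integrable.of_bound (hwm n).aestronglyMeasurable B (Eventually.of_forall (hwB n))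
    exact (integrableOn_iff_integrable_of_support_subset support_indicator_subset).1 this
  have hconv : ∀ x ε, ∃ l, Tendsto (fun n => ∫ y in ball x ε, w n y) atTop (𝓝 l) := by
    intro x ε
    obtain ⟨l, hl⟩ := hlim (indicatorConstLp 2 (measurableSet_ball (x := x) (ε := ε))
      (measure_ne_top _ _) (1 : ℝ))
    refine ⟨l, hl.congr fun n => ?_⟩
    rw [real_inner_comm, L2.inner_indicatorConstLp_one,
      integral_congr_ae (ae_restrict_of_ae (hwv n).symm),
      Measure.restrict_restrict measurableSet_ball]
    refine setIntegral_eq_of_subset_of_forall_sdiff_eq_zero measurableSet_ball inter_subset_left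
      (fun y hy => ?_) |>.symm
    exact indicator_of_notMem (fun h => hy.2 ⟨hy.1, h⟩) _
  have hL1 := tendsto_setIntegral_abs_sub hΩ hΩb hwm hwi hwB hC
    (fun n => (totalVariation_congr_ae (hwv n)).trans_le (hv _)) hconv
  rw [cauchySeq_iff_tendsto_dist_atTop_0]
  -- The uniform bound absorbs one factor of the square, so `L^1` convergence controls `L^2`
  -- distance.
  have hsq : ∀ p : ℕ × ℕ, dist (v (φ p.1)) (v (φ p.2)) ^ 2 ≤
      (B + B) * ∫ x in Ω, |w p.1 x - w p.2 x| := fun p => by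
    rw [dist_eq_norm, norm_sq_eq_setIntegral, ← integral_const_mul]
    refine integral_mono_of_nonneg (Eventually.of_forall fun x => sq_nonneg _)
      (((hwi _).sub (hwi _)).abs.const_mul _).integrableOn ?_
    filter_upwards [Lp.coeFn_sub (v (φ p.1)) (v (φ p.2)), hwv p.1, hwv p.2] with x hx h1 h2
    rw [hx, Pi.sub_apply, ← h1, ← h2, ← sq_abs, sq]
    gcongr
    exact (abs_sub _ _).trans (add_le_add (hwB _ _) (hwB _ _))
  have h0 : Tendsto (fun p : ℕ × ℕ => dist (v (φ p.1)) (v (φ p.2)) ^ 2) atTop (𝓝 0) :=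
    squeeze_zero (fun p => sq_nonneg _) hsq (by simpa using hL1.const_mul (B + B))
  have := (Real.continuous_sqrt.tendsto 0).comp h0
  simpa [Function.comp_def, Real.sqrt_sq dist_nonneg] using this

/-! ### Lower semicontinuity and closedness -/

/-- Integration by parts against the constant `1`, whose derivative vanishes. -/
theorem integral_divergence_eq_zero {d : ℕ}
    {φ : EuclideanSpace ℝ (Fin d) → EuclideanSpace ℝ (Fin d)} (hφ : ContDiff ℝ 1 φ)
    (hφc : HasCompactSupport φ) : ∫ x, divergence φ x = 0 := by
  have hcd := hφ.continuous_fderiv one_ne_zero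
  have hi : ∀ e, Integrable fun x => fderiv ℝ φ x e := fun e =>
    Continuous.integrable_of_hasCompactSupport (by fun_prop) (hφc.fderiv_apply (𝕜 := ℝ) e)
  have hz : ∀ e, ∫ x, fderiv ℝ φ x e = 0 := fun e => by
    have := integral_smul_fderiv_eq_neg_fderiv_smul_of_integrable (μ := volume)
      (f := fun _ : EuclideanSpace ℝ (Fin d) => (1 : ℝ)) (g := φ) (v := e)
      (by simp) (by simpa using hi e)
      (by simpa using hφ.continuous.integrable_of_hasCompactSupport hφc)
      (fun x _ => differentiableAt_const _) (fun x _ => hφ.differentiable one_ne_zero x)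
    simpa using this
  have hcomm : ∀ i : Fin d, ∀ e, ∫ x, (fderiv ℝ φ x e) i = (∫ x, fderiv ℝ φ x e) i :=
    fun i e => (EuclideanSpace.proj (𝕜 := ℝ) i).integral_comp_comm (hi e)
  unfold divergence
  rw [integral_finsetSum _ fun i _ => by
    simpa using (EuclideanSpace.proj (𝕜 := ℝ) i).integrable_comp (hi (EuclideanSpace.single i 1))]
  simp [hcomm, hz]

theorem totalVariation_const {d : ℕ} (Ω : Set (EuclideanSpace ℝ (Fin d))) (c : ℝ) :
    totalVariation Ω (fun _ => c) = 0 := by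
  refine le_antisymm (iSup₂_le fun φ hφ => ?_) zero_le
  rw [integral_const_mul, setIntegral_eq_integral_of_forall_compl_eq_zero fun x hx =>
    divergence_eq_zero_of_notMem_tsupport fun h => hx (hφ.tsupport_subset h),
    integral_divergence_eq_zero hφ.contDiff hφ.hasCompactSupport]
  simp

/-- The divergence of a test field is continuous with compact support, hence in `L^2`. The total
variation is thus a supremum of continuous functions of `v`. -/
theorem lowerSemicontinuous_totalVariation {d : ℕ} (Ω : Set (EuclideanSpace ℝ (Fin d))) :
    LowerSemicontinuous fun v : L2 Ω => totalVariation Ω v := by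
  unfold totalVariation
  refine lowerSemicontinuous_iSup fun φ => lowerSemicontinuous_iSup fun hφ =>
    Continuous.lowerSemicontinuous (ENNReal.continuous_ofReal.comp ?_)
  have hL : MemLp (divergence φ) 2 (volume.restrict Ω) :=
    ((continuous_divergence hφ.contDiff).memLp_of_hasCompactSupport
      (hasCompactSupport_divergence hφ.hasCompactSupport)).restrict Ω
  have : (fun v : L2 Ω => ∫ x in Ω, v x * divergence φ x) =
      fun v : L2 Ω => inner ℝ (hL.toLp _) v := by
    ext v
    rw [L2.inner_def]
    refine integral_congr_ae (hL.coeFn_toLp.mono fun x hx => ?_)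
    simp [hx]
  rw [this]
  fun_prop

/-- An `L^2` limit is an a.e. limit along a subsequence, and a finite set of values is closed. -/
theorem isClosed_feasibleSet {d M : ℕ} (Ω : Set (EuclideanSpace ℝ (Fin d))) (ν : Fin M → ℤ) :
    IsClosed (feasibleSet Ω ν) := by
  refine IsSeqClosed.isClosed fun v a hv ha => ?_
  obtain ⟨ns, -, hns⟩ := (tendstoInMeasure_of_tendsto_Lp ha).exists_seq_tendsto_ae
  have hT : IsClosed (range fun i => (ν i : ℝ)) := (finite_range _).isClosed
  filter_upwards [hns, ae_all_iff.2 hv] with x hx hvx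
  obtain ⟨i, hi⟩ := hT.mem_of_tendsto hx (Eventually.of_forall fun n => by
    obtain ⟨i, hi⟩ := hvx (ns n)
    exact ⟨i, hi.symm⟩)
  exact ⟨i, hi.symm⟩

theorem ae_abs_le_of_mem_feasibleSet {d M : ℕ} {Ω : Set (EuclideanSpace ℝ (Fin d))}
    {ν : Fin M → ℤ} {v : L2 Ω} (hv : v ∈ feasibleSet Ω ν) :
    ∀ᵐ x ∂volume.restrict Ω, |v x| ≤ ∑ i, |(ν i : ℝ)| :=
  Eventually.mono (f := ae (volume.restrict Ω)) hv fun _ ⟨i, hi⟩ => hi ▸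
    Finset.single_le_sum (f := fun i => |(ν i : ℝ)|) (fun _ _ => abs_nonneg _) (Finset.mem_univ i)

/-- Sublevel sets of the total variation in the feasible set are compact in `L^2`. -/
theorem isCompact_feasibleSet_inter {d M : ℕ} {Ω : Set (EuclideanSpace ℝ (Fin d))}
    (hΩ : IsOpen Ω) (hΩb : Bornology.IsBounded Ω) (ν : Fin M → ℤ) {C : ℝ} (hC : 0 ≤ C) :
    IsCompact (feasibleSet Ω ν ∩ {v : L2 Ω | totalVariation Ω v ≤ ENNReal.ofReal C}) := by
  have hcl : IsClosed (feasibleSet Ω ν ∩ {v : L2 Ω | totalVariation Ω v ≤ ENNReal.ofReal C}) :=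
    (isClosed_feasibleSet Ω ν).inter
      ((lowerSemicontinuous_totalVariation Ω).isClosed_preimage (ENNReal.ofReal C))
  refine IsSeqCompact.isCompact fun v hv => ?_
  obtain ⟨φ, hφ, a, ha⟩ := exists_subseq_tendsto_of_totalVariation_le hΩ hΩb
    (Finset.sum_nonneg fun i _ => abs_nonneg _)
    (fun n => ae_abs_le_of_mem_feasibleSet (hv n).1) hC fun n => (hv n).2
  exact ⟨a, hcl.mem_of_tendsto ha (Eventually.of_forall fun n => hv _), φ, hφ, ha⟩

/-- In `ℝ≥0∞`, multiplication by a finite constant is continuous and monotone, which avoids sign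
conditions in `EReal`. -/
theorem objective_eq {d : ℕ} (Ω : Set (EuclideanSpace ℝ (Fin d))) (F : L2 Ω → ℝ) {α : ℝ}
    (hα : 0 ≤ α) (v : L2 Ω) :
    objective Ω F α v =
      (F v : EReal) + ((ENNReal.ofReal α * totalVariation Ω v : ℝ≥0∞) : EReal) := by
  rw [objective, EReal.coe_ennreal_mul, EReal.coe_ennreal_ofReal, max_eq_left hα]

theorem lowerSemicontinuous_objective {d : ℕ} {Ω : Set (EuclideanSpace ℝ (Fin d))}
    {F : L2 Ω → ℝ} (hF : LowerSemicontinuous F) {α : ℝ} (hα : 0 ≤ α) :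
    LowerSemicontinuous (objective Ω F α) := by
  rw [funext (objective_eq Ω F hα)]
  refine LowerSemicontinuous.add' ?_ ?_ fun v => EReal.continuousAt_add (by simp) (by simp)
  · exact continuous_coe_real_ereal.comp_lowerSemicontinuous hF
      fun a b h => EReal.coe_le_coe_iff.2 h
  · refine (continuous_coe_ennreal_ereal.comp
      (ENNReal.continuous_const_mul ENNReal.ofReal_ne_top)).comp_lowerSemicontinuous
      (lowerSemicontinuous_totalVariation Ω) fun a b h => ?_
    exact EReal.coe_ennreal_le_coe_ennreal_iff.2 (mul_le_mul_right h _)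

end TVControl

end

/-! ### The direct method -/

theorem proposition2p2 {d M : ℕ} (hd : 1 ≤ d) (hM : 1 ≤ M)
    (Ω : Set (EuclideanSpace ℝ (Fin d))) (hΩ_open : IsOpen Ω) (hΩ_bdd : Bornology.IsBounded Ω)
    (ν : Fin M → ℤ) (hν : StrictMono ν) (α : ℝ) (hα : 0 < α)
    (F : TVControl.L2 Ω → ℝ) (hF_lsc : LowerSemicontinuous F)
    (hF_bdd : BddBelow (Set.range F)) :
    ∃ v : TVControl.L2 Ω, v ∈ TVControl.feasibleSet Ω ν ∧ TVControl.MemBV Ω v ∧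
      IsMinOn (TVControl.objective Ω F α) (TVControl.feasibleSet Ω ν) v := by
  open TVControl in
  have hfin : IsFiniteMeasure (volume.restrict Ω) := ⟨by simpa using hΩ_bdd.measure_lt_top⟩
  obtain ⟨m, hm⟩ := hF_bdd
  have hm' : ∀ v, m ≤ F v := fun v => hm ⟨v, rfl⟩
  let v₀ : L2 Ω := (memLp_const (ν ⟨0, hM⟩ : ℝ)).toLp _
  have hv₀ : ⇑v₀ =ᵐ[volume.restrict Ω] fun _ => (ν ⟨0, hM⟩ : ℝ) := MemLp.coeFn_toLp _
  have hv₀f : v₀ ∈ feasibleSet Ω ν := Filter.Eventually.mono (f := ae (volume.restrict Ω)) hv₀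
    fun x hx => ⟨_, hx⟩
  have hv₀TV : totalVariation Ω v₀ = 0 := by
    rw [totalVariation_congr_ae hv₀, totalVariation_const]
  -- The threshold is where `m + α * TV` reaches `F v₀`, the objective at the constant control `v₀`;
  -- beyond it no control does better than `v₀`.
  have hC : 0 ≤ (F v₀ - m) / α := div_nonneg (sub_nonneg.2 (hm' _)) hα.le
  have hv₀C : v₀ ∈ feasibleSet Ω ν ∩
      {v : L2 Ω | totalVariation Ω v ≤ ENNReal.ofReal ((F v₀ - m) / α)} :=
    ⟨hv₀f, by simp [hv₀TV]⟩
  have hcpt := isCompact_feasibleSet_inter hΩ_open hΩ_bdd ν hC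
  obtain ⟨v, ⟨hvf, hvTV⟩, hmin⟩ := LowerSemicontinuousOn.exists_isMinOn
    (Set.nonempty_of_mem hv₀C) hcpt ((lowerSemicontinuous_objective hF_lsc hα.le).lowerSemicontinuousOn _)
  refine ⟨v, hvf, ⟨(Lp.memLp v).integrable (by norm_num), hvTV.trans_lt ENNReal.ofReal_lt_top⟩,
    fun u hu => ?_⟩
  by_cases huTV : totalVariation Ω u ≤ ENNReal.ofReal ((F v₀ - m) / α)
  · exact hmin ⟨hu, huTV⟩
  calc objective Ω F α v ≤ objective Ω F α v₀ := hmin hv₀C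
    _ = (F v₀ : EReal) := by simp [objective, hv₀TV]
    _ = (m : EReal) + ((ENNReal.ofReal (F v₀ - m) : ℝ≥0∞) : EReal) := by
      rw [EReal.coe_ennreal_ofReal, max_eq_left (sub_nonneg.2 (hm' _)), ← EReal.coe_add,
        add_sub_cancel]
    _ ≤ (F u : EReal) + ((ENNReal.ofReal α * totalVariation Ω u : ℝ≥0∞) : EReal) := by
      refine add_le_add (EReal.coe_le_coe_iff.2 (hm' u))
        (EReal.coe_ennreal_le_coe_ennreal_iff.2 ?_)
      rw [← mul_div_cancel₀ (F v₀ - m) hα.ne', ENNReal.ofReal_mul hα.le]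
      gcongr
      exact (not_le.1 huTV).le
    _ = objective Ω F α u := (objective_eq Ω F hα.le u).symm
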